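/- All Hilbert spaces are complex. Let $\mathcal{B}(\mathcal{H})$ be the algebra of bounded operators on a Hilbert space $\mathcal{H}$. An operator $T\in\mathcal{B}(\mathcal{H})$ is *similar to a contraction* if there is a positive invertible $A\in\mathcal{B}(\mathcal{H})$ with $T^*AT\le A$ (equivalently, $XTX^{-1}$ is a contraction for some invertible $X\in\mathcal{B}(\mathcal{H})$); $S\in\mathcal{B}(\mathcal{K})$ is *similar to an isometry* if $XSX^{-1}$ is an isometry for some invertible $X\in\mathcal{B}(\mathcal{K})$, it is *left invertible* if it is injective with closed range, and it is a *quasi-isometry* if $S^{*2}S^2=S^*S$. If $\mathcal{K}$ contains $\mathcal{H}$ as a closed subspace and $P:\mathcal{K}\to\mathcal{H}$ is the orthogonal projection, then $S\in\mathcal{B}(\mathcal{K})$ is a *lifting* of $T\in\mathcal{B}(\mathcal{H})$ if $PS=TP$, and it is *minimal* if $\mathcal{K}$ is the closed linear span of $\bigcup_{n\ge 0}S^n\mathcal{H}$. (1) For every Hilbert space $\mathcal{H}$, every operator $T\in\mathcal{B}(\mathcal{H})$ similar to a contraction has, on some Hilbert space $\mathcal{K}\supset\mathcal{H}$, a minimal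 quasi-isometric lifting $S$ that is similar to an isometry and, in particular, left invertible. (2) Such a lifting need not satisfy $S^*S\mathcal{H}\subset\mathcal{H}$: there are a Hilbert space $\mathcal{H}$ and an operator $T\in\mathcal{B}(\mathcal{H})$ similar to a contraction such that $S^*S\mathcal{H}\not\subset\mathcal{H}$ for every left invertible quasi-isometric lifting $S$ of $T$ (minimal or not). -/

import Mathlib

open ContinuousLinearMap

universe u v

section Operators

variable {H : Type*} [NormedAddCommGroup H] [InnerProductSpace ℂ H] [CompleteSpace H]
variable {K : Type*} [NormedAddCommGroup K] [InnerProductSpace ℂ K] [CompleteSpace K]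

/-- `T` is similar to a contraction: there is a positive invertible operator `A` with
`T* A T ≤ A` (Loewner order). See `isSimilarToContraction_iff_isConj` for the equivalence with
`T = X⁻¹ C X`, `‖C‖ ≤ 1`. -/
def IsSimilarToContraction (T : H →L[ℂ] H) : Prop :=
  ∃ A : H →L[ℂ] H, A.IsPositive ∧ IsUnit A ∧ adjoint T * A * T ≤ A

/-- `S` is similar to an isometry: `X S = V X` with `X` invertible in `B(K)` and `V* V = I`. -/
def IsSimilarToIsometry (S : K →L[ℂ] K) : Prop :=
  ∃ V : K →L[ℂ] K, adjoint V * V = 1 ∧ IsConj S V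

/-- `S` is left invertible: injective with closed range. -/
def IsLeftInvertibleOp (S : K →L[ℂ] K) : Prop :=
  Function.Injective S ∧ IsClosed (Set.range S)

/-- `S` is a quasi-isometry: `S*² S² = S* S`. -/
def IsQuasiIsometry (S : K →L[ℂ] K) : Prop :=
  adjoint S ^ 2 * S ^ 2 = adjoint S * S

/-- `S` on `K ⊇ H` is a lifting of `T` on `H`: `P S = T P`, where the inclusion of `H` into `K` is
the linear isometry `J` and `P = J*` is the projection of `K` onto `H`. -/
def IsLifting (J : H →ₗᵢ[ℂ] K) (T : H →L[ℂ] H) (S : K →L[ℂ] K) : Prop :=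
  adjoint J.toContinuousLinearMap ∘L S = T ∘L adjoint J.toContinuousLinearMap

/-- Minimality of a lifting: `K` is the closed linear span of `⋃ₙ Sⁿ H`, `n ≥ 0`. -/
def IsMinimalLifting (J : H →ₗᵢ[ℂ] K) (S : K →L[ℂ] K) : Prop :=
  (Submodule.span ℂ (⋃ n : ℕ, Set.range fun h : H => (S ^ n) (J h))).topologicalClosure = ⊤

/-- `S* S H ⊆ H`, where `H` is the subspace `J(H)` of `K`. -/
def AdjointMulSelfLeavesInvariant (J : H →ₗᵢ[ℂ] K) (S : K →L[ℂ] K) : Prop :=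
  ∀ h : H, (adjoint S * S) (J h) ∈ Set.range J

/-- `T` is similar to a contraction iff it is conjugate, by an invertible element of `B(H)`, to an
operator of norm at most one. -/
theorem isSimilarToContraction_iff_isConj (T : H →L[ℂ] H) :
    IsSimilarToContraction T ↔ ∃ C : H →L[ℂ] H, ‖C‖ ≤ 1 ∧ IsConj T C := by
  have key (C : H →L[ℂ] H) : ‖C‖ ≤ 1 ↔ star C * C ≤ 1 := by
    rw [← CStarAlgebra.norm_le_one_iff_of_nonneg (star C * C) (star_mul_self_nonneg C),
      CStarRing.norm_star_mul_self]
    constructor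
    · intro h
      exact mul_le_one₀ h (norm_nonneg _) h
    · intro h
      nlinarith [norm_nonneg C]
  constructor
  · rintro ⟨A, hA, hu, hle⟩
    have hA0 : 0 ≤ A := (nonneg_iff_isPositive A).2 hA
    set R := CFC.sqrt A with hR
    have hRR : R * R = A := CFC.sqrt_mul_sqrt_self A
    have hRs : star R = R := (IsSelfAdjoint.of_nonneg (CFC.sqrt_nonneg A)).star_eq
    have hRu : IsUnit R := by
      have hc : Commute R R := Commute.refl R
      exact (hc.isUnit_mul_iff.1 (hRR ▸ hu)).1
    obtain ⟨X, hX⟩ := hRu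
    refine ⟨(X : H →L[ℂ] H) * T * (X⁻¹ : (H →L[ℂ] H)ˣ), ?_, X, ?_⟩
    · rw [key]
      have hXs : star (X : H →L[ℂ] H) = X := by rw [hX, hRs]
      have hXi : star ((X⁻¹ : (H →L[ℂ] H)ˣ) : H →L[ℂ] H) = (X⁻¹ : (H →L[ℂ] H)ˣ) := by
        have : star X = X := Units.ext (by simpa using hXs)
        rw [← Units.coe_star, star_inv, this]
      have h1 := star_left_conjugate_le_conjugate hle ((X⁻¹ : (H →L[ℂ] H)ˣ) : H →L[ℂ] H)
      rw [← hRR, ← hX, hXi] at h1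
      have e : (↑X⁻¹ : H →L[ℂ] H) * (↑X * ↑X) * ↑X⁻¹ = 1 := by simp
      rw [e] at h1
      simpa [star_mul, hXs, hXi, mul_assoc, star_eq_adjoint] using h1
    · simp [SemiconjBy, mul_assoc]
  · rintro ⟨C, hC, X, hX⟩
    refine ⟨star (X : H →L[ℂ] H) * X, (nonneg_iff_isPositive _).1 (star_mul_self_nonneg _),
      X.isUnit.star.mul X.isUnit, ?_⟩
    have h1 := star_left_conjugate_le_conjugate ((key C).1 hC) (X : H →L[ℂ] H)
    have h2 : (X : H →L[ℂ] H) * T = C * X := hX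
    calc adjoint T * (star (X : H →L[ℂ] H) * X) * T
        = star ((X : H →L[ℂ] H) * T) * (X * T) := by
          simp only [star_mul, ← star_eq_adjoint, mul_assoc]
      _ = star (X : H →L[ℂ] H) * (star C * C) * X := by
          rw [h2]; simp only [star_mul, mul_assoc]
      _ ≤ _ := by simpa using h1

end Operators

/-! ### Quasi-isometries and liftings through norms and inner products -/

section NormCriteria

variable {H : Type*} [NormedAddCommGroup H] [InnerProductSpace ℂ H] [CompleteSpace H]
variable {K : Type*} [NormedAddCommGroup K] [InnerProductSpace ℂ K] [CompleteSpace K]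

/-! (1) Write `T = Y C X` with `C` a contraction, `Y = X⁻¹` and, after scaling, `‖Y‖ ≤ 1`. Then `X
X* ≥ 1`, so `X X* = 1 + F²` with `F` self-adjoint, and `J x = (Y* x, F Y* x, 0, …)` embeds `H`
isometrically in `ℓ²(ℕ, H)` with `J* f = Y (f 0 + F (f 1))`. The operator `S` of `exists_skewShift`
feeds `w = f 0 + F (f 1)` into an isometric dilation of `C`. As `S f` vanishes at coordinate 1, its
own `w` is `C w`: this gives both `J* S = Y C w = T J*` and `‖S (S f)‖ = ‖S f‖`. `S` is bounded
below, and `IsLifting.exists_minimal` cuts it down to a minimal lifting.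

(2) An involution is similar to a contraction, but by `IsLifting.norm_map_of_involution` invariance
of `H` under `S* S` would make it isometric; an oblique reflection of `ℂ²` is not. -/

theorem adjoint_mul_self_eq_iff_norm (A B : K →L[ℂ] K) :
    adjoint A * A = adjoint B * B ↔ ∀ x, ‖A x‖ = ‖B x‖ := by
  rw [← ContinuousLinearMap.coe_inj, ← ext_inner_map]
  refine forall_congr' fun x => ?_
  rw [coe_coe, coe_coe, mul_apply_eq_comp, mul_apply_eq_comp, adjoint_inner_left, adjoint_inner_left,
    inner_self_eq_norm_sq_to_K, inner_self_eq_norm_sq_to_K]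
  norm_cast
  rw [sq_eq_sq₀ (norm_nonneg _) (norm_nonneg _)]

theorem isQuasiIsometry_iff_norm (S : K →L[ℂ] K) :
    IsQuasiIsometry S ↔ ∀ x, ‖S (S x)‖ = ‖S x‖ := by
  have h : adjoint S ^ 2 = adjoint (S ^ 2) := by
    rw [← star_eq_adjoint, ← star_eq_adjoint, star_pow]
  rw [IsQuasiIsometry, h, adjoint_mul_self_eq_iff_norm]
  rfl

theorem isLifting_iff_inner (J : H →ₗᵢ[ℂ] K) (T : H →L[ℂ] H) (S : K →L[ℂ] K) :
    IsLifting J T S ↔ ∀ h k, inner ℂ (J h) (S k) = inner ℂ (J (adjoint T h)) k := by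
  rw [IsLifting, ContinuousLinearMap.ext_iff, forall_comm]
  refine forall_congr' fun k => ?_
  rw [ext_iff_inner_left ℂ]
  refine forall_congr' fun h => ?_
  rw [comp_apply, comp_apply, adjoint_inner_right, ← adjoint_inner_left T,
    adjoint_inner_right]
  rfl

theorem isLeftInvertibleOp_of_bound (S : K →L[ℂ] K) {c : ℝ} (hb : ∀ x, ‖x‖ ≤ c * ‖S x‖) :
    IsLeftInvertibleOp S := by
  have hanti : AntilipschitzWith c.toNNReal S :=
    S.antilipschitz_of_bound fun x => (hb x).trans
      (mul_le_mul_of_nonneg_right (Real.le_coe_toNNReal c) (norm_nonneg _))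
  exact ⟨hanti.injective, hanti.isClosed_range S.uniformContinuous⟩

/-- A quasi-isometry which is bounded below is similar to an isometry, via the square root of
`S* S`. -/
theorem IsQuasiIsometry.isSimilarToIsometry {S : K →L[ℂ] K} (hS : IsQuasiIsometry S) {c : ℝ}
    (hb : ∀ x, ‖x‖ ≤ c * ‖S x‖) : IsSimilarToIsometry S := by
  have hA0 : 0 ≤ star S * S := star_mul_self_nonneg S
  have hu : IsUnit (star S * S) := by
    -- `c` is not assumed positive; `d` is a positive substitute.
    set d : ℝ := |c| + 1
    have hd : 0 < d := by positivity
    have hb' : ∀ x, ‖x‖ ≤ d * ‖S x‖ := fun x => (hb x).trans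
      (mul_le_mul_of_nonneg_right ((le_abs_self c).trans (le_add_of_nonneg_right zero_le_one))
        (norm_nonneg _))
    refine isUnit_of_forall_le_norm_inner_map _ (c := ⟨(d ^ 2)⁻¹, by positivity⟩)
      (show (0 : ℝ) < (d ^ 2)⁻¹ by positivity) fun x => ?_
    rw [star_eq_adjoint, mul_apply_eq_comp, adjoint_inner_left, inner_self_eq_norm_sq_to_K]
    have h1 : ‖x‖ ^ 2 ≤ d ^ 2 * ‖S x‖ ^ 2 := by
      rw [← mul_pow]
      exact pow_le_pow_left₀ (norm_nonneg _) (hb' x) 2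
    have h2 : ‖((‖S x‖ : ℂ)) ^ 2‖ = ‖S x‖ ^ 2 := by simp
    change ‖x‖ ^ 2 * (d ^ 2)⁻¹ ≤ ‖((‖S x‖ : ℂ)) ^ 2‖
    rw [h2, ← div_eq_mul_inv, div_le_iff₀ (by positivity)]
    linarith
  set R := CFC.sqrt (star S * S)
  have hRR : R * R = star S * S := CFC.sqrt_mul_sqrt_self _
  have hRs : star R = R := (IsSelfAdjoint.of_nonneg (CFC.sqrt_nonneg _)).star_eq
  obtain ⟨X, hX⟩ : IsUnit R := ((Commute.refl R).isUnit_mul_iff.1 (hRR ▸ hu)).1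
  rw [← hX] at hRs hRR
  have hXi : star ((X⁻¹ : (K →L[ℂ] K)ˣ) : K →L[ℂ] K) = (X⁻¹ : (K →L[ℂ] K)ˣ) := by
    have : star X = X := Units.ext (by simpa using hRs)
    rw [← Units.coe_star, star_inv, this]
  refine ⟨X * S * (X⁻¹ : (K →L[ℂ] K)ˣ), ?_, X, by simp [SemiconjBy, mul_assoc]⟩
  have hq : star S * (star S * S) * S = star S * S := by
    have := hS
    rw [IsQuasiIsometry, ← star_eq_adjoint, pow_two, pow_two] at this
    simpa [mul_assoc] using this
  rw [← star_eq_adjoint, star_mul, star_mul, hXi, hRs]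
  calc (X⁻¹ : (K →L[ℂ] K)ˣ) * (star S * (X : K →L[ℂ] K)) * (X * S * (X⁻¹ : (K →L[ℂ] K)ˣ))
      = (X⁻¹ : (K →L[ℂ] K)ˣ) * (star S * ((X : K →L[ℂ] K) * X) * S) * (X⁻¹ : (K →L[ℂ] K)ˣ) := by
        simp only [mul_assoc]
    _ = 1 := by rw [hRR, hq, ← hRR]; simp

/-- Restricting a lifting to the closed span of the orbits of `H` makes it minimal; the
quasi-isometry property and lower bounds are inherited. -/
theorem IsLifting.exists_minimal {H K : Type u} [NormedAddCommGroup H] [InnerProductSpace ℂ H]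
    [CompleteSpace H] [NormedAddCommGroup K] [InnerProductSpace ℂ K] [CompleteSpace K]
    {J : H →ₗᵢ[ℂ] K} {T : H →L[ℂ] H} {S : K →L[ℂ] K} (hL : IsLifting J T S)
    (hS : IsQuasiIsometry S) {c : ℝ} (hb : ∀ x, ‖x‖ ≤ c * ‖S x‖) :
    ∃ (K' : Type u) (_ : NormedAddCommGroup K') (_ : InnerProductSpace ℂ K')
      (_ : CompleteSpace K') (J' : H →ₗᵢ[ℂ] K') (S' : K' →L[ℂ] K'),
      IsLifting J' T S' ∧ IsQuasiIsometry S' ∧ IsMinimalLifting J' S' ∧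
        ∀ x, ‖x‖ ≤ c * ‖S' x‖ := by
  set G : Set K := ⋃ n : ℕ, Set.range fun h : H => (S ^ n) (J h)
  set M : Submodule ℂ K := (Submodule.span ℂ G).topologicalClosure
  have hGM : G ⊆ M := Submodule.subset_span.trans (Submodule.le_topologicalClosure _)
  have hSM : ∀ x ∈ M, S x ∈ M := by
    have h1 : Submodule.span ℂ G ≤ M.comap (S : K →ₗ[ℂ] K) := by
      rw [Submodule.span_le]
      intro x hx
      obtain ⟨n, h, rfl⟩ := Set.mem_iUnion.1 hx
      refine hGM (Set.mem_iUnion.2 ⟨n + 1, h, ?_⟩)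
      simp only [pow_succ']
      rfl
    exact fun x hx => Submodule.topologicalClosure_minimal _ h1
      ((Submodule.isClosed_topologicalClosure _).preimage S.continuous) hx
  have hJM : ∀ h, J h ∈ M := fun h => hGM (Set.mem_iUnion.2 ⟨0, h, by simp⟩)
  have : CompleteSpace M := (Submodule.isClosed_topologicalClosure _).completeSpace_coe
  let J' : H →ₗᵢ[ℂ] M := ⟨J.toLinearMap.codRestrict M hJM, fun x => J.norm_map x⟩
  let S' : M →L[ℂ] M := (S.comp M.subtypeL).codRestrict M fun x => hSM x x.2
  have hpow : ∀ (n : ℕ) (x : M), ((S' ^ n) x : K) = (S ^ n) x := by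
    intro n
    induction n with
    | zero => intro x; rfl
    | succ n ih =>
      intro x
      rw [pow_succ, pow_succ, mul_apply_eq_comp, mul_apply_eq_comp, ih]
      rfl
  -- The criteria by inner products and norms restrict to `M` verbatim, so the adjoint of `S'` is
  -- never computed.
  refine ⟨M, inferInstance, inferInstance, this, J', S', ?_, ?_, ?_, fun x => hb x⟩
  · rw [isLifting_iff_inner] at hL ⊢
    exact fun h k => hL h k
  · rw [isQuasiIsometry_iff_norm] at hS ⊢
    exact fun x => hS x
  · set G' : Set M := ⋃ n : ℕ, Set.range fun h : H => (S' ^ n) (J' h)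
    have hG : Subtype.val '' G' = G := by
      simp only [G', G, Set.image_iUnion, ← Set.range_comp]
      refine Set.iUnion_congr fun n => congrArg Set.range (funext fun h => hpow n (J' h))
    -- A vector of `M` orthogonal to the orbits is orthogonal to their closed span `M`, hence to
    -- itself.
    rw [IsMinimalLifting, Submodule.topologicalClosure_eq_top_iff, Submodule.eq_bot_iff]
    intro x hx
    have hx' : (x : K) ∈ (Submodule.span ℂ G)ᗮ := by
      rw [Submodule.mem_orthogonal] at hx ⊢
      intro y hy
      induction hy using Submodule.span_induction with
      | mem y hy =>
        rw [← hG] at hy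
        obtain ⟨z, hz, rfl⟩ := hy
        exact hx z (Submodule.subset_span hz)
      | zero => simp
      | add y z _ _ hy hz => rw [inner_add_left, hy, hz, add_zero]
      | smul a y _ hy => rw [inner_smul_left, hy, mul_zero]
    rw [← Submodule.orthogonal_closure] at hx'
    have := Submodule.inner_right_of_mem_orthogonal x.2 hx'
    exact Subtype.ext (inner_self_eq_zero.1 this)

end NormCriteria

/-! ### Involutions and the failure of invariance -/

section Counterexample

variable {H : Type*} [NormedAddCommGroup H] [InnerProductSpace ℂ H] [CompleteSpace H]
variable {K : Type*} [NormedAddCommGroup K] [InnerProductSpace ℂ K] [CompleteSpace K]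

/-- Averaging over the group `{1, T}`: `A = 1 + T* T` satisfies `T* A T = A`. -/
theorem isSimilarToContraction_of_involution {T : H →L[ℂ] H} (hT : T * T = 1) :
    IsSimilarToContraction T := by
  have h0 : 0 ≤ star T * T := star_mul_self_nonneg T
  have h1 : (1 : H →L[ℂ] H) ≤ 1 + star T * T := le_add_of_nonneg_right h0
  refine ⟨1 + star T * T, (nonneg_iff_isPositive _).1 (zero_le_one.trans h1),
    CStarAlgebra.isUnit_of_le 1 h1, le_of_eq ?_⟩
  have hs : star T * star T = 1 := by rw [← star_mul, hT, star_one]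
  rw [← star_eq_adjoint, mul_add, add_mul, mul_one]
  rw [show star T * (star T * T) * T = (star T * star T) * (T * T) by simp only [mul_assoc],
    hs, hT, mul_one, add_comm]

/-- If an involution has an injective quasi-isometric lifting whose modulus leaves `H` invariant,
then it is isometric. -/
theorem IsLifting.norm_map_of_involution {J : H →ₗᵢ[ℂ] K} {T : H →L[ℂ] H} {S : K →L[ℂ] K}
    (hL : IsLifting J T S) (hT : T * T = 1) (hS : IsQuasiIsometry S)
    (hinj : Function.Injective S) (hinv : AdjointMulSelfLeavesInvariant J S) (h : H) :
    ‖T h‖ = ‖h‖ := by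
  have hTT : ∀ h, T (T h) = h := fun h => DFunLike.congr_fun hT h
  have hQ := (isQuasiIsometry_iff_norm S).1 hS
  have hort : ∀ g h : H, inner ℂ (J g) (S (J h) - J (T h)) = 0 := by
    intro g h
    rw [inner_sub_right, (isLifting_iff_inner J T S).1 hL, J.inner_map_map, J.inner_map_map,
      adjoint_inner_left, sub_self]
  -- Pythagoras: `S* S J T h` lies in `J(H)`, to which `S J h - J T h` is orthogonal.
  have hsplit : ∀ h, ‖S (J h)‖ ^ 2 = ‖S (J (T h))‖ ^ 2 + ‖S (S (J h) - J (T h))‖ ^ 2 := by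
    intro h
    have h0 : inner ℂ (S (J (T h))) (S (S (J h) - J (T h))) = 0 := by
      obtain ⟨g, hg⟩ := hinv (T h)
      rw [← adjoint_inner_left, ← mul_apply_eq_comp, ← hg, hort]
    have h1 : S (S (J h)) = S (J (T h)) + S (S (J h) - J (T h)) := by
      rw [← map_add, add_sub_cancel]
    rw [← hQ, h1, @norm_add_sq ℂ, h0]
    simp
  -- Adding the splittings for `h` and `T h` cancels the main terms, as `T² = 1`; both defects
  -- vanish.
  have hST : ∀ h, S (J h) = J (T h) := by
    intro h
    have h1 := hsplit h
    have h2 := hsplit (T h)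
    rw [hTT] at h2
    have h3 : ‖S (S (J h) - J (T h))‖ = 0 := by
      rw [← sq_eq_zero_iff]
      nlinarith [sq_nonneg ‖S (S (J h) - J (T h))‖, sq_nonneg ‖S (S (J (T h)) - J h)‖]
    exact sub_eq_zero.1 (hinj ((norm_eq_zero.1 h3).trans S.map_zero.symm))
  have := hQ (J h)
  rw [hST, hST, hTT, J.norm_map, J.norm_map] at this
  exact this.symm

theorem exists_nonisometric_involution :
    ∃ (T : EuclideanSpace ℂ (ULift.{u} (Fin 2)) →L[ℂ] EuclideanSpace ℂ (ULift.{u} (Fin 2)))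
      (h : EuclideanSpace ℂ (ULift.{u} (Fin 2))), T * T = 1 ∧ ‖T h‖ ≠ ‖h‖ := by
  set a : EuclideanSpace ℂ (ULift.{u} (Fin 2)) := EuclideanSpace.single ⟨0⟩ 1
  set b : EuclideanSpace ℂ (ULift.{u} (Fin 2)) := EuclideanSpace.single ⟨1⟩ 1
  have hab : inner ℂ a b = 0 := by simp [a, b, EuclideanSpace.inner_single_left]
  have ha : ‖a‖ = 1 := by simp [a]
  have hb : ‖b‖ = 1 := by simp [b]
  have haa : inner ℂ a a = (1 : ℂ) := by rw [inner_self_eq_norm_sq_to_K, ha]; simp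
  -- `T = 1 - 2E` with `E x = ⟨a, x⟩ (a + b)` a non-orthogonal idempotent.
  let T : EuclideanSpace ℂ (ULift.{u} (Fin 2)) →L[ℂ] EuclideanSpace ℂ (ULift.{u} (Fin 2)) :=
    1 - (2 : ℂ) • (innerSL ℂ a).smulRight (a + b)
  have hTx : ∀ x, T x = x - ((2 : ℂ) * inner ℂ a x) • (a + b) := fun x => by
    simp [T, mul_smul]
  refine ⟨T, a, ?_, ?_⟩
  · ext1 x
    rw [mul_apply_eq_comp, hTx, hTx, one_apply_eq_self, inner_sub_right, inner_smul_right, inner_add_right, haa,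
      hab]
    module
  · have h1 : T a = -(a + (2 : ℂ) • b) := by
      rw [hTx, haa]; module
    have h2 : ‖T a‖ ^ 2 = 5 := by
      rw [h1, norm_neg, @norm_add_sq ℂ, inner_smul_right, hab, norm_smul, ha, hb]
      norm_num
    intro h
    rw [h, ha] at h2
    norm_num at h2

end Counterexample

/-! ### The lifting on `ℓ²(ℕ, H)` -/

section Dilation

variable {H : Type*} [NormedAddCommGroup H] [InnerProductSpace ℂ H]

local notation "ℓH" => lp (fun _ : ℕ => H) 2

/-- The inclusion of `H` as the `i`-th coordinate of `ℓ²(ℕ, H)`. -/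
noncomputable def lpSingleIsometry (H : Type*) [NormedAddCommGroup H] [InnerProductSpace ℂ H]
    (i : ℕ) : H →ₗᵢ[ℂ] lp (fun _ : ℕ => H) 2 where
  toLinearMap := lp.lsingle (𝕜 := ℂ) (E := fun _ : ℕ => H) 2 i
  norm_map' x := lp.norm_single (E := fun _ : ℕ => H) (p := 2) two_pos i x

theorem orthogonalFamily_single_add (m : ℕ) :
    OrthogonalFamily ℂ (fun _ : ℕ => H) fun i => lpSingleIsometry H (i + m) := by
  intro i j hij x y
  change inner ℂ (lp.single 2 (i + m) x : ℓH) (lp.single 2 (j + m) y : ℓH) = 0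
  rw [lp.inner_single_left, lp.single_apply_ne _ _ _ (by omega), inner_zero_right]

theorem lp_norm_sq_single_zero_add (f : ℓH) :
    ‖f - lp.single 2 0 (f 0)‖ ^ 2 + ‖f 0‖ ^ 2 = ‖f‖ ^ 2 := by
  have h := @norm_sub_sq ℂ ℓH _ _ _ f (lp.single 2 0 (f 0))
  rw [lp.inner_single_right, lp.norm_single (by norm_num), inner_self_eq_norm_sq] at h
  linarith

variable [CompleteSpace H]

/-- There is an isometry of `ℓ²(ℕ, H)` shifting the coordinates by `m` places. -/
theorem exists_shift (m : ℕ) : ∃ W : ℓH →ₗᵢ[ℂ] ℓH,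
    (∀ f, ∀ i < m, W f i = 0) ∧ ∀ f i, W f (i + m) = f i := by
  have key : ∀ (f : ℓH) (j : ℕ), HasSum (fun i => (lp.single 2 (i + m) (f i) : ℓH) j)
      ((orthogonalFamily_single_add (H := H) m).linearIsometry f j) := fun f j =>
    ((orthogonalFamily_single_add (H := H) m).hasSum_linearIsometry f).mapL
      (lp.evalCLM ℂ (fun _ : ℕ => H) 2 j)
  refine ⟨(orthogonalFamily_single_add m).linearIsometry, fun f i hi => ?_, fun f i => ?_⟩
  · refine (key f i).unique ?_
    convert hasSum_zero using 2 with k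
    exact lp.single_apply_ne _ _ _ (by omega)
  · refine (key f (i + m)).unique ?_
    convert hasSum_single i fun k hk => ?_ using 1
    · rw [lp.single_apply_self]
    · exact lp.single_apply_ne _ _ _ (by omega)

theorem norm_sq_eq_re_inner_adjoint_mul_self (A : H →L[ℂ] H) (x : H) :
    ‖A x‖ ^ 2 = (inner ℂ ((star A * A) x) x).re :=
  apply_norm_sq_eq_inner_adjoint_left A x

/-- Defect operator of a contraction. -/
theorem exists_defect {C : H →L[ℂ] H} (hC : ‖C‖ ≤ 1) :
    ∃ D : H →L[ℂ] H, ∀ x, ‖C x‖ ^ 2 + ‖D x‖ ^ 2 = ‖x‖ ^ 2 := by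
  have h1 : star C * C ≤ 1 := by
    rw [← CStarAlgebra.norm_le_one_iff_of_nonneg (star C * C) (star_mul_self_nonneg C),
      CStarRing.norm_star_mul_self]
    exact mul_le_one₀ hC (norm_nonneg _) hC
  have hs : star (CFC.sqrt (1 - star C * C)) * CFC.sqrt (1 - star C * C) = 1 - star C * C := by
    rw [(IsSelfAdjoint.of_nonneg (CFC.sqrt_nonneg _)).star_eq,
      CFC.sqrt_mul_sqrt_self _ (sub_nonneg.2 h1)]
  refine ⟨CFC.sqrt (1 - star C * C), fun x => ?_⟩
  rw [norm_sq_eq_re_inner_adjoint_mul_self, norm_sq_eq_re_inner_adjoint_mul_self, hs,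
    sub_apply, inner_sub_left, one_apply_eq_self, Complex.sub_re, add_sub_cancel]
  exact inner_self_eq_norm_sq (𝕜 := ℂ) x

/-- Conjugating `Y Y* ≤ 1` by `X` gives `1 ≤ X X*`; `F` is the square root of the difference. -/
theorem exists_sqrt_mul_star_sub_one {X Y : H →L[ℂ] H} (hXY : X * Y = 1) (hY : ‖Y‖ ≤ 1) :
    ∃ F : H →L[ℂ] H, star F = F ∧ 1 + F * F = X * star X := by
  have h1 : Y * star Y ≤ 1 := by
    rw [← CStarAlgebra.norm_le_one_iff_of_nonneg (Y * star Y) (mul_star_self_nonneg Y),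
      CStarRing.norm_self_mul_star]
    exact mul_le_one₀ hY (norm_nonneg _) hY
  have h2 : 1 ≤ X * star X := by
    have := star_right_conjugate_le_conjugate h1 X
    rwa [mul_one, show X * (Y * star Y) * star X = (X * Y) * star (X * Y) by
      rw [star_mul]; simp only [mul_assoc], hXY, star_one, mul_one] at this
  refine ⟨CFC.sqrt (X * star X - 1), (IsSelfAdjoint.of_nonneg (CFC.sqrt_nonneg _)).star_eq, ?_⟩
  rw [CFC.sqrt_mul_sqrt_self _ (sub_nonneg.2 h2), add_sub_cancel]

/-- The lifting on `ℓ²(ℕ, H)` acting by `f ↦ (C w, 0, D w, f 1, f 2, …)`, `w = f 0 + F (f 1)`,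
where `D` is the defect operator of the contraction `C`. -/
theorem exists_skewShift {C : H →L[ℂ] H} (hC : ‖C‖ ≤ 1) (F : H →L[ℂ] H) :
    ∃ S : ℓH →L[ℂ] ℓH, (∀ f, S f 0 = C (f 0 + F (f 1))) ∧ (∀ f, S f 1 = 0) ∧
      ∀ f, ‖S f‖ ^ 2 = ‖f 0 + F (f 1)‖ ^ 2 + (‖f‖ ^ 2 - ‖f 0‖ ^ 2) := by
  obtain ⟨D, hD⟩ := exists_defect hC
  -- Coordinate 0 is removed before shifting by two, so coordinates 0, 1 and 2 are free for `C w`,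
  -- `0` and `D w`.
  obtain ⟨W, hW0, hW⟩ := exists_shift (H := H) 2
  let π (i : ℕ) : ℓH →L[ℂ] H := lp.evalCLM ℂ (fun _ : ℕ => H) 2 i
  let ι (i : ℕ) : H →L[ℂ] ℓH := lp.singleContinuousLinearMap ℂ (fun _ : ℕ => H) 2 i
  let w : ℓH →L[ℂ] H := π 0 + F ∘L π 1
  let S : ℓH →L[ℂ] ℓH := ι 0 ∘L C ∘L w + ι 2 ∘L D ∘L w +
    W.toContinuousLinearMap ∘L (ContinuousLinearMap.id ℂ ℓH - ι 0 ∘L π 0)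
  have hS : ∀ f : ℓH, S f = lp.single 2 0 (C (f 0 + F (f 1))) + lp.single 2 2 (D (f 0 + F (f 1)))
      + W (f - lp.single 2 0 (f 0)) := fun f => rfl
  have hcoe : ∀ (f : ℓH) (i : ℕ), S f i = (lp.single 2 0 (C (f 0 + F (f 1))) : ℓH) i +
      (lp.single 2 2 (D (f 0 + F (f 1))) : ℓH) i + W (f - lp.single 2 0 (f 0)) i :=
    fun f i => by rw [hS]; rfl
  refine ⟨S, fun f => ?_, fun f => ?_, fun f => ?_⟩
  · rw [hcoe, hW0 _ _ (by norm_num), lp.single_apply_self, lp.single_apply_ne _ _ _ (by norm_num),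
      add_zero, add_zero]
  · rw [hcoe, hW0 _ _ (by norm_num), lp.single_apply_ne _ _ _ (by norm_num),
      lp.single_apply_ne _ _ _ (by norm_num), add_zero, add_zero]
  · set g := f - lp.single 2 0 (f 0) with hg
    have hg0 : g 0 = 0 := by
      change f 0 - (lp.single 2 0 (f 0) : ℓH) 0 = 0
      rw [lp.single_apply_self, sub_self]
    have hW2 : W g 2 = 0 := (hW g 0).trans hg0
    rw [hS, ← hg, @norm_add_sq ℂ, @norm_add_sq ℂ, inner_add_left, lp.inner_single_left,
      lp.inner_single_left, lp.inner_single_left, hW0 _ _ (by norm_num), hW2,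
      lp.single_apply_ne _ _ _ (by norm_num), lp.norm_single (by norm_num),
      lp.norm_single (by norm_num), W.norm_map, ← lp_norm_sq_single_zero_add f, ← hg,
      ← hD (f 0 + F (f 1))]
    simp

/-- For `J x = (Y* x, F Y* x, 0, …)`, `(1 + F²) Y* = X X* Y* = X`, whence `J* J = Y X = 1`. -/
theorem exists_embedding {X Y F : H →L[ℂ] H} (hYX : Y * X = 1) (hF : star F = F)
    (hFX : 1 + F * F = X * star X) :
    ∃ J : H →ₗᵢ[ℂ] ℓH, ∀ x f, inner ℂ (J x) f = inner ℂ x (Y (f 0 + F (f 1))) := by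
  let ι (i : ℕ) : H →L[ℂ] ℓH := lp.singleContinuousLinearMap ℂ (fun _ : ℕ => H) 2 i
  let J : H →L[ℂ] ℓH := ι 0 ∘L adjoint Y + ι 1 ∘L F ∘L adjoint Y
  have hJ : ∀ x, J x = lp.single 2 0 (adjoint Y x) + lp.single 2 1 (F (adjoint Y x)) :=
    fun x => rfl
  have hin : ∀ x f, inner ℂ (J x) f = inner ℂ x (Y (f 0 + F (f 1))) := by
    intro x f
    have hF' : inner ℂ (F (adjoint Y x)) (f 1) = inner ℂ (adjoint Y x) (F (f 1)) := by
      rw [← adjoint_inner_left, ← star_eq_adjoint F, hF]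
    rw [hJ, inner_add_left, lp.inner_single_left, lp.inner_single_left, hF', ← inner_add_right,
      adjoint_inner_left]
  refine ⟨⟨J.toLinearMap, fun x => ?_⟩, hin⟩
  have hXY : star X * star Y = 1 := by rw [← star_mul, hYX, star_one]
  have h0 : (J x) 0 + F ((J x) 1) = X x := by
    have e0 : (J x) 0 = adjoint Y x := by
      rw [hJ]
      change (lp.single 2 0 _ : ℓH) 0 + (lp.single 2 1 _ : ℓH) 0 = _
      rw [lp.single_apply_self, lp.single_apply_ne _ _ _ (by norm_num), add_zero]
    have e1 : (J x) 1 = F (adjoint Y x) := by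
      rw [hJ]
      change (lp.single 2 0 _ : ℓH) 1 + (lp.single 2 1 _ : ℓH) 1 = _
      rw [lp.single_apply_self, lp.single_apply_ne _ _ _ (by norm_num), zero_add]
    rw [e0, e1]
    have : (1 + F * F) * star Y = X := by rw [hFX, mul_assoc, hXY, mul_one]
    exact DFunLike.congr_fun this x
  have h1 := hin x (J x)
  rw [h0, ← mul_apply_eq_comp, hYX, one_apply_eq_self, inner_self_eq_norm_sq_to_K, inner_self_eq_norm_sq_to_K]
    at h1
  norm_cast at h1
  exact (sq_eq_sq₀ (norm_nonneg _) (norm_nonneg _)).1 h1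

/-- An operator similar to a contraction has a quasi-isometric lifting which is bounded below. -/
theorem IsSimilarToContraction.exists_lifting {T : H →L[ℂ] H} (hT : IsSimilarToContraction T) :
    ∃ (J : H →ₗᵢ[ℂ] ℓH) (S : ℓH →L[ℂ] ℓH) (c : ℝ),
      IsLifting J T S ∧ IsQuasiIsometry S ∧ ∀ x, ‖x‖ ≤ c * ‖S x‖ := by
  obtain ⟨C, hC, U, hU⟩ := (isSimilarToContraction_iff_isConj T).1 hT
  obtain ⟨X, Y, hXY, hYX, hY, hYC⟩ : ∃ X Y : H →L[ℂ] H, X * Y = 1 ∧ Y * X = 1 ∧ ‖Y‖ ≤ 1 ∧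
      Y * C = T * Y := by
    -- Rescaling the similarity leaves the conjugation unchanged and makes `‖Y‖ ≤ 1`.
    set r : ℝ := ‖((U⁻¹ : (H →L[ℂ] H)ˣ) : H →L[ℂ] H)‖ + 1
    have hr : 0 < r := by positivity
    have hrc : (r : ℂ) ≠ 0 := by exact_mod_cast hr.ne'
    refine ⟨(r : ℂ) • (U : H →L[ℂ] H), (r : ℂ)⁻¹ • ((U⁻¹ : (H →L[ℂ] H)ˣ) : H →L[ℂ] H),
      ?_, ?_, ?_, ?_⟩
    · rw [smul_mul_smul_comm, mul_inv_cancel₀ hrc, one_smul, Units.mul_inv]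
    · rw [smul_mul_smul_comm, inv_mul_cancel₀ hrc, one_smul, Units.inv_mul]
    · rw [norm_smul, norm_inv, Complex.norm_real, Real.norm_of_nonneg hr.le,
        inv_mul_le_iff₀ hr, mul_one]
      exact le_add_of_nonneg_right zero_le_one
    · have hU' : (U : H →L[ℂ] H) * T = C * U := hU
      have : ((U⁻¹ : (H →L[ℂ] H)ˣ) : H →L[ℂ] H) * C = T * (U⁻¹ : (H →L[ℂ] H)ˣ) := by
        rw [Units.inv_mul_eq_iff_eq_mul, ← mul_assoc, hU', mul_assoc, Units.mul_inv, mul_one]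
      rw [smul_mul_assoc, mul_smul_comm, this]
  obtain ⟨F, hF, hFX⟩ := exists_sqrt_mul_star_sub_one hXY hY
  obtain ⟨J, hJ⟩ := exists_embedding hYX hF hFX
  obtain ⟨S, hS0, hS1, hS⟩ := exists_skewShift hC F
  -- With `g` the part of `f` off coordinate 0, `‖f‖ ≤ ‖g‖ + ‖w‖ + ‖F‖ ‖f 1‖`, and `‖g‖`, `‖w‖`, `‖f
  -- 1‖` are each at most `‖S f‖`.
  refine ⟨J, S, 2 + ‖F‖, ?_, ?_, fun f => ?_⟩
  · rw [isLifting_iff_inner]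
    intro h k
    rw [hJ, hJ, hS0, hS1, map_zero, add_zero, adjoint_inner_left, ← mul_apply_eq_comp, hYC, mul_apply_eq_comp]
  · rw [isQuasiIsometry_iff_norm]
    intro f
    rw [← sq_eq_sq₀ (norm_nonneg _) (norm_nonneg _), hS (S f), hS1, map_zero, add_zero,
      add_sub_cancel]
  · have hN := hS f
    set g := f - lp.single 2 0 (f 0) with hg
    have hsplit := lp_norm_sq_single_zero_add f
    rw [← hg] at hsplit
    have hg1 : ‖f 1‖ ≤ ‖g‖ := by
      have : g 1 = f 1 := by
        change f 1 - (lp.single 2 0 (f 0) : ℓH) 1 = f 1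
        rw [lp.single_apply_ne _ _ _ (by norm_num), sub_zero]
      rw [← this]
      exact lp.norm_apply_le_norm (by norm_num) g 1
    have hgS : ‖g‖ ≤ ‖S f‖ :=
      (sq_le_sq₀ (norm_nonneg _) (norm_nonneg _)).1 (by nlinarith [sq_nonneg ‖f 0 + F (f 1)‖])
    have hwS : ‖f 0 + F (f 1)‖ ≤ ‖S f‖ :=
      (sq_le_sq₀ (norm_nonneg _) (norm_nonneg _)).1 (by nlinarith [sq_nonneg ‖g‖])
    have hf : ‖f‖ ≤ ‖g‖ + ‖f 0‖ :=
      (sq_le_sq₀ (norm_nonneg _) (by positivity)).1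
        (by nlinarith [mul_nonneg (norm_nonneg g) (norm_nonneg (f 0))])
    have hf0 : ‖f 0‖ ≤ ‖f 0 + F (f 1)‖ + ‖F (f 1)‖ := by
      simpa using norm_sub_le (f 0 + F (f 1)) (F (f 1))
    have hF1 : ‖F (f 1)‖ ≤ ‖F‖ * ‖S f‖ := (F.le_opNorm _).trans
      (mul_le_mul_of_nonneg_left (hg1.trans hgS) (norm_nonneg _))
    linarith

end Dilation

theorem corollary3p3 :
    (∀ (H : Type u) [NormedAddCommGroup H] [InnerProductSpace ℂ H] [CompleteSpace H]
        (T : H →L[ℂ] H), IsSimilarToContraction T →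
      ∃ (K : Type u) (_ : NormedAddCommGroup K) (_ : InnerProductSpace ℂ K)
        (_ : CompleteSpace K) (J : H →ₗᵢ[ℂ] K) (S : K →L[ℂ] K),
        IsLifting J T S ∧ IsQuasiIsometry S ∧ IsMinimalLifting J S ∧
          IsSimilarToIsometry S ∧ IsLeftInvertibleOp S) ∧
    (∃ (H : Type u) (_ : NormedAddCommGroup H) (_ : InnerProductSpace ℂ H)
        (_ : CompleteSpace H) (T : H →L[ℂ] H), IsSimilarToContraction T ∧
      ∀ (K : Type v) [NormedAddCommGroup K] [InnerProductSpace ℂ K] [CompleteSpace K]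
        (J : H →ₗᵢ[ℂ] K) (S : K →L[ℂ] K),
        IsLifting J T S → IsQuasiIsometry S → IsLeftInvertibleOp S →
          ¬ AdjointMulSelfLeavesInvariant J S) := by
  constructor
  · intro H _ _ _ T hT
    obtain ⟨J₀, S₀, c, hL₀, hQ₀, hb₀⟩ := hT.exists_lifting
    obtain ⟨K, iK, iK', iK'', J, S, hL, hQ, hM, hb⟩ := hL₀.exists_minimal hQ₀ hb₀
    exact ⟨K, iK, iK', iK'', J, S, hL, hQ, hM, hQ.isSimilarToIsometry hb,
      isLeftInvertibleOp_of_bound S hb⟩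
  · obtain ⟨T, h, hT, hne⟩ := exists_nonisometric_involution.{u}
    refine ⟨_, inferInstance, inferInstance, inferInstance, T,
      isSimilarToContraction_of_involution hT, ?_⟩
    intro K _ _ _ J S hL hQ hI hinv
    exact hne (hL.norm_map_of_involution hT hQ hI.1 hinv h)
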